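/- Let $d\ge 0$, $k\ge 1$, $\sigma>0$, let $\mathcal X\subseteq\mathbb R^d$ (the data manifold), and let $m:\mathbb R^d\to[0,1]$ (the original model) be $\gamma_m$-Lipschitz for the Euclidean norm. Let $M$ be a random function $\mathbb R^d\to[0,1]$ (the changed model) obtained from $m$ by \emph{naturally-occurring model change}, that is: (1) $\mathbb E[M(y)]=m(y)$ for every $y\in\mathbb R^d$; (2) every realization of $M$ is $\gamma$-Lipschitz, with one constant $\gamma$ for all realizations; (3) $\operatorname{Var}(M(y))\le\nu$ for every $y\in\mathcal X$, where $\nu$ is a constant. Assume $\gamma_m+\gamma>0$. Fix $x\in\mathbb R^d$, let $X_1,\dots,X_k$ be i.i.d. with distribution $\mathcal N(x,\sigma^2 I_d)$, with $(X_1,\dots,X_k)$ independent of $M$, and put $$Z=\frac1k\sum_{i=1}^k\bigl(m(X_i)-M(X_i)\bigr),\qquad R_{k,\sigma^2}(x,m)=\frac1k\sum_{i=1}^k\bigl(m(X_i)-\gamma\|x-X_i\|\bigr);$$ $R_{k,\sigma^2}(x,m)$ is the \emph{Stability} of $x$. Suppose that $|\mathbb E[Z\mid M]-\mathbb E[Z]|<\epsilon'$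 almost surely. Then, for every $\epsilon>2\epsilon'$, $$\Pr\bigl(M(x)\ge R_{k,\sigma^2}(x,m)-\epsilon\bigr)\ \ge\ 1-\exp\Bigl(\frac{-k\epsilon^2}{8(\gamma_m+\gamma)^2\sigma^2}\Bigr),$$ where the probability is over both $M$ and $X_1,\dots,X_k$. This holds for every $x\in\mathbb R^d$, in particular for every counterfactual $x\in\mathcal X$ (a point with $m(x)\ge 1/2$). -/

import Mathlib

open MeasureTheory ProbabilityTheory
open scoped NNReal

namespace Counterfactual

/-- A machine learning model on `ℝ^d`: it outputs a probability in `[0, 1]` at every input. -/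
def IsModel {d : ℕ} (f : EuclideanSpace ℝ (Fin d) → ℝ) : Prop :=
  ∀ y, f y ∈ Set.Icc (0 : ℝ) 1

/-- Naturally-occurring model change from the model `m` to the random model `M`, with data
manifold `𝒳`. The random model is measurable for the product σ-algebra on functions, i.e. all its
evaluations `M(y)` are random variables. -/
structure IsNaturallyOccurring {d : ℕ} {Ω : Type*} [MeasurableSpace Ω] (P : Measure Ω)
    (𝒳 : Set (EuclideanSpace ℝ (Fin d))) (m : EuclideanSpace ℝ (Fin d) → ℝ)
    (M : Ω → EuclideanSpace ℝ (Fin d) → ℝ) (γm γ : ℝ≥0) (ν : ℝ) : Prop where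
  measurable : Measurable M
  isModel : ∀ ω, IsModel (M ω)
  /-- the changed model is centred at the original one -/
  mean_eq : ∀ y, ∫ ω, M ω y ∂P = m y
  /-- whenever `m` is `γm`-Lipschitz, every realization of `M` is `γ`-Lipschitz -/
  lipschitz : LipschitzWith γm m → ∀ ω, LipschitzWith γ (M ω)
  /-- on the data manifold the variance of the output is at most `ν` -/
  variance_le : ∀ y ∈ 𝒳, Var[fun ω => M ω y; P] ≤ ν

/-- The Stability measure `R_{k,σ²}(x,m)`, as a function of the `k` sampled points. -/
noncomputable def stability {d k : ℕ} (γ : ℝ≥0) (x : EuclideanSpace ℝ (Fin d))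
    (m : EuclideanSpace ℝ (Fin d) → ℝ) (xs : Fin k → EuclideanSpace ℝ (Fin d)) : ℝ :=
  (1 / (k : ℝ)) * ∑ i, (m (xs i) - γ * ‖x - xs i‖)

/-- The random variable `Z = (1/k) ∑ i, (m(X_i) - M(X_i))`. -/
noncomputable def meanDiff {d k : ℕ} {Ω : Type*} (m : EuclideanSpace ℝ (Fin d) → ℝ)
    (M : Ω → EuclideanSpace ℝ (Fin d) → ℝ) (X : Fin k → Ω → EuclideanSpace ℝ (Fin d)) :
    Ω → ℝ :=
  fun ω => (1 / (k : ℝ)) * ∑ i, (m (X i ω) - M ω (X i ω))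

end Counterfactual

/-! ### Exponential moments of bounded centred variables. -/

namespace Counterfactual

/-! Since `M` is `γ`-Lipschitz, `stability - M x ≤ Z` pointwise (`stability_sub_le_meanDiff`), so
the desired inequality can fail only where `Z > ε`. Centring and independence give `E[Z] = 0`, and
`E[Z | M = f]` is the Gaussian mean of `m - f`; the hypothesis thus says that this mean is below `ε'
< ε/2` for almost every realization `f`. For such an `f`, `Z` is an average of `k` i.i.d. values of
a `(γm + γ)`-Lipschitz function of a Gaussian, and it must exceed its mean by `ε/2`. Gaussian
concentration bounds this conditional probability, and Fubini integrates the bound over `M`.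

The analytic core is Gaussian concentration with variance proxy exactly `L²σ²`. The Gaussian of
standard deviation `σ` is split into `n` independent steps of size `h = σ/√n`. One step multiplies
the exponential moment by at most `exp(t²V/2 + O(h³))`, where `V` bounds the local variance
(`gaussAvg_exp_le`). Averaging preserves the Lipschitz constant, the sup bound and the bound `V`, so
the steps can be iterated (`gaussAvg_iterate_exp_le`). If the derivative of the function is
Lipschitz, `V = L²h² + O(h³)`; as `n h² = σ²`, letting `n → ∞` leaves `t²L²σ²/2`. Mollification then
removes the smoothness assumption. -/

theorem exp_le_quadratic_add_cubic {u b : ℝ} (hu : |u| ≤ b) :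
    Real.exp u ≤ 1 + u + u ^ 2 / 2 + Real.exp b * |u| ^ 3 := by
  have h := Complex.norm_exp_sub_sum_le_norm_mul_exp (u : ℂ) 3
  have h2 : (Complex.exp u - ∑ m ∈ Finset.range 3, (u : ℂ) ^ m / m.factorial)
      = ((Real.exp u - (1 + u + u ^ 2 / 2) : ℝ) : ℂ) := by
    simp [Finset.sum_range_succ, Nat.factorial]
  rw [h2, Complex.norm_real, Complex.norm_real, Real.norm_eq_abs, Real.norm_eq_abs] at h
  have h3 : Real.exp |u| ≤ Real.exp b := Real.exp_le_exp.2 hu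
  have h4 := (abs_le.1 h).2
  have h5 : |u| ^ 3 * Real.exp |u| ≤ |u| ^ 3 * Real.exp b := by gcongr
  linarith

/-- A bounded measurable function is integrable for a finite measure. -/
theorem integrable_of_abs_le {α : Type*} [MeasurableSpace α] {μ : Measure α} [IsFiniteMeasure μ]
    {f : α → ℝ} (hf : Measurable f) {B : ℝ} (hB : ∀ a, |f a| ≤ B) : Integrable f μ :=
  Integrable.of_bound hf.aestronglyMeasurable B (ae_of_all _ hB)

theorem abs_integral_le_of_abs_le {α : Type*} [MeasurableSpace α] {μ : Measure α}
    [IsProbabilityMeasure μ] {f : α → ℝ} {B : ℝ} (hB : ∀ a, |f a| ≤ B) : |∫ a, f a ∂μ| ≤ B := by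
  simpa using norm_integral_le_of_norm_le_const (μ := μ) (f := f) (ae_of_all _ hB)

/-- Centring kills the linear Taylor term. The final `1 + s ≤ exp s` puts the bound in exponential
form, so that errors of successive steps add up. -/
theorem integral_exp_le_of_integral_eq_zero {α : Type*} [MeasurableSpace α] {μ : Measure α}
    [IsProbabilityMeasure μ] {u : α → ℝ} (hu : Measurable u) {b : ℝ} (hb : ∀ a, |u a| ≤ b)
    (h0 : ∫ a, u a ∂μ = 0) :
    ∫ a, Real.exp (u a) ∂μ ≤
      Real.exp ((∫ a, u a ^ 2 ∂μ) / 2 + Real.exp b * ∫ a, |u a| ^ 3 ∂μ) := by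
  have i1 : Integrable u μ := integrable_of_abs_le hu hb
  have i2 : Integrable (fun a => u a ^ 2) μ := by
    refine integrable_of_abs_le (B := b ^ 2) (by fun_prop) fun a => ?_
    rw [abs_pow]; gcongr; exact hb a
  have i3 : Integrable (fun a => |u a| ^ 3) μ := by
    refine integrable_of_abs_le (B := b ^ 3) (by fun_prop) fun a => ?_
    rw [abs_pow, abs_abs]; gcongr; exact hb a
  have ie : Integrable (fun a => Real.exp (u a)) μ := by
    refine integrable_of_abs_le (B := Real.exp b) (by fun_prop) fun a => ?_
    rw [Real.abs_exp]; exact Real.exp_le_exp.2 ((le_abs_self _).trans (hb a))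
  have j1 : Integrable (fun a => 1 + u a) μ := (integrable_const 1).add i1
  have j2 : Integrable (fun a => 1 + u a + u a ^ 2 / 2) μ := j1.add (i2.div_const 2)
  calc ∫ a, Real.exp (u a) ∂μ
      ≤ ∫ a, (1 + u a + u a ^ 2 / 2 + Real.exp b * |u a| ^ 3) ∂μ :=
        integral_mono ie (j2.add (i3.const_mul _)) fun a => exp_le_quadratic_add_cubic (hb a)
    _ = ((∫ a, u a ^ 2 ∂μ) / 2 + Real.exp b * ∫ a, |u a| ^ 3 ∂μ) + 1 := by
        rw [integral_add j2 (i3.const_mul _), integral_add j1 (i2.div_const 2),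
          integral_add (integrable_const 1) i1, h0, integral_div, integral_const_mul]
        simp
        ring
    _ ≤ _ := Real.add_one_le_exp _

theorem sq_integral_le_integral_sq {α : Type*} [MeasurableSpace α] {μ : Measure α}
    [IsProbabilityMeasure μ] {f : α → ℝ} (hf : Measurable f) {B : ℝ} (hB : ∀ a, |f a| ≤ B) :
    (∫ a, f a ∂μ) ^ 2 ≤ ∫ a, f a ^ 2 ∂μ := by
  have h := variance_nonneg f μ
  have hm : MemLp f 2 μ := MemLp.of_bound hf.aestronglyMeasurable B (ae_of_all _ hB)
  rw [variance_eq_sub hm] at h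
  simpa using h

/-! ### Gaussian averaging as a semigroup, and iteration of small steps. -/

variable {E : Type*} [NormedAddCommGroup E] [InnerProductSpace ℝ E] [FiniteDimensional ℝ E]
  [MeasurableSpace E] [BorelSpace E]

/-- The Gaussian average of `G`, with standard deviation `h` in every direction. -/
noncomputable def gaussAvg (h : ℝ) (G : E → ℝ) (x : E) : ℝ :=
  ∫ ξ, G (x + h • ξ) ∂stdGaussian E

theorem map_smul_stdGaussian_conv {a b c : ℝ} (hc : c ^ 2 = a ^ 2 + b ^ 2) :
    ((stdGaussian E).map (a • ·)) ∗ ((stdGaussian E).map (b • ·)) =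
      (stdGaussian E).map (c • ·) := by
  have : ∀ r : ℝ, IsProbabilityMeasure ((stdGaussian E).map (r • ·)) := fun r =>
    Measure.isProbabilityMeasure_map (by fun_prop)
  apply Measure.ext_of_charFun
  ext t
  rw [charFun_conv, charFun_map_smul, charFun_map_smul, charFun_map_smul]
  simp only [charFun_stdGaussian, norm_smul, Real.norm_eq_abs]
  rw [← Complex.exp_add]
  congr 1
  have : ((c : ℂ)) ^ 2 = (a : ℂ) ^ 2 + (b : ℂ) ^ 2 := by exact_mod_cast hc
  push_cast
  simp only [mul_pow, ← Complex.ofReal_pow, sq_abs]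
  push_cast
  rw [this]
  ring

theorem integrable_comp_add_smul {G : E → ℝ} (hG : Continuous G) {B : ℝ} (hB : ∀ y, |G y| ≤ B)
    (h : ℝ) (x : E) : Integrable (fun ξ => G (x + h • ξ)) (stdGaussian E) :=
  integrable_of_abs_le (hG.comp (by fun_prop)).measurable fun _ => hB _

theorem gaussAvg_gaussAvg {a b c : ℝ} (hc : c ^ 2 = a ^ 2 + b ^ 2) {G : E → ℝ}
    (hG : Continuous G) {B : ℝ} (hB : ∀ y, |G y| ≤ B) (x : E) :
    gaussAvg a (gaussAvg b G) x = gaussAvg c G x := by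
  have : ∀ r : ℝ, IsProbabilityMeasure ((stdGaussian E).map (r • ·)) := fun r =>
    Measure.isProbabilityMeasure_map (by fun_prop)
  have hx : Continuous fun y => G (x + y) := by fun_prop
  have h1 : gaussAvg c G x = ∫ y, G (x + y) ∂((stdGaussian E).map (c • ·)) := by
    rw [integral_map (by fun_prop) hx.aestronglyMeasurable]; rfl
  have hi := integrable_of_abs_le (μ := ((stdGaussian E).map (a • ·)) ∗
    ((stdGaussian E).map (b • ·))) hx.measurable fun _ => hB _
  rw [h1, ← map_smul_stdGaussian_conv hc, integral_conv hi, integral_map (by fun_prop)]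
  · refine integral_congr_ae (ae_of_all _ fun ξ => ?_)
    simp only
    rw [integral_map (by fun_prop) (by fun_prop)]
    simp [gaussAvg, add_assoc]
  · refine StronglyMeasurable.aestronglyMeasurable ?_
    exact StronglyMeasurable.integral_prod_right'
      (f := fun p : E × E => G (x + (p.1 + p.2))) (Continuous.stronglyMeasurable (by fun_prop))

theorem lipschitzWith_gaussAvg {G : E → ℝ} {L : ℝ≥0} (hG : LipschitzWith L G) {B : ℝ}
    (hB : ∀ y, |G y| ≤ B) (h : ℝ) : LipschitzWith L (gaussAvg h G) := by
  refine LipschitzWith.of_dist_le_mul fun x y => ?_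
  rw [Real.dist_eq, gaussAvg, gaussAvg, ← integral_sub
    (integrable_comp_add_smul hG.continuous hB h x) (integrable_comp_add_smul hG.continuous hB h y)]
  refine abs_integral_le_of_abs_le fun ξ => ?_
  simpa only [Real.dist_eq, dist_add_right] using hG.dist_le_mul (x + h • ξ) (y + h • ξ)

theorem abs_gaussAvg_le {G : E → ℝ} {B : ℝ} (hB : ∀ y, |G y| ≤ B) (h : ℝ) (x : E) :
    |gaussAvg h G x| ≤ B := abs_integral_le_of_abs_le fun _ => hB _

/-- The local Gaussian variance of `G`. -/
noncomputable def gaussVar (h : ℝ) (G : E → ℝ) (x : E) : ℝ :=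
  ∫ ξ, (G (x + h • ξ) - gaussAvg h G x) ^ 2 ∂stdGaussian E

/-- Averaging commutes with translations, so by Jensen and Fubini the local variance of an average
is at most the average of the local variances. Thus the variance bound survives iteration, and no
derivative has to be followed. -/
theorem gaussVar_gaussAvg_le {G : E → ℝ} {L : ℝ≥0} (hG : LipschitzWith L G) {B : ℝ}
    (hB : ∀ y, |G y| ≤ B) (h : ℝ) {V : ℝ} (hV : ∀ x, gaussVar h G x ≤ V) (x : E) :
    gaussVar h (gaussAvg h G) x ≤ V := by
  have hc := hG.continuous
  have hA := (lipschitzWith_gaussAvg hG hB h).continuous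
  let D : E → E → ℝ := fun ξ η => G (x + h • η + h • ξ) - gaussAvg h G (x + h • η)
  have hDc : Continuous (Function.uncurry D) := by unfold D Function.uncurry; fun_prop
  have hDb : ∀ ξ η, |D ξ η| ≤ B + B := fun ξ η =>
    (abs_sub _ _).trans (add_le_add (hB _) (abs_gaussAvg_le hB _ _))
  have hD2b : ∀ ξ η, |D ξ η ^ 2| ≤ (B + B) ^ 2 := fun ξ η => by
    rw [abs_pow]; gcongr; exact hDb ξ η
  have key : ∀ ξ, gaussAvg h G (x + h • ξ) - gaussAvg h (gaussAvg h G) x =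
      ∫ η, D ξ η ∂stdGaussian E := fun ξ => by
    unfold D
    rw [integral_sub]
    · congr 1
      simp only [gaussAvg]
      congr with η
      rw [add_right_comm]
    · exact integrable_of_abs_le (Continuous.measurable (by fun_prop)) fun _ => hB _
    · exact integrable_comp_add_smul hA (abs_gaussAvg_le hB h) h x
  have i2 : Integrable (Function.uncurry fun ξ η => D ξ η ^ 2)
      ((stdGaussian E).prod (stdGaussian E)) :=
    integrable_of_abs_le (hDc.pow 2).measurable fun p => hD2b p.1 p.2
  calc gaussVar h (gaussAvg h G) x
      = ∫ ξ, (∫ η, D ξ η ∂stdGaussian E) ^ 2 ∂stdGaussian E := by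
        unfold gaussVar; simp_rw [key]
    _ ≤ ∫ ξ, ∫ η, D ξ η ^ 2 ∂stdGaussian E ∂stdGaussian E := by
        refine integral_mono_of_nonneg (ae_of_all _ fun _ => sq_nonneg _) i2.integral_prod_left
          (ae_of_all _ fun ξ => ?_)
        exact sq_integral_le_integral_sq
          (hDc.comp (Continuous.prodMk_right ξ)).measurable (hDb ξ)
    _ = ∫ η, gaussVar h G (x + h • η) ∂stdGaussian E := integral_integral_swap i2
    _ ≤ ∫ _η : E, V ∂stdGaussian E := by
        refine integral_mono_of_nonneg (ae_of_all _ fun _ => ?_) (integrable_const V)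
          (ae_of_all _ fun η => hV _)
        exact integral_nonneg fun _ => sq_nonneg _
    _ = V := by simp

variable (E) in
/-- A cubic moment of the standard Gaussian. -/
noncomputable def gaussCube : ℝ :=
  ∫ ξ : E, (‖ξ‖ + ∫ η : E, ‖η‖ ∂stdGaussian E) ^ 3 ∂stdGaussian E

theorem integrable_norm_pow_stdGaussian (n : ℕ) :
    Integrable (fun ξ : E => ‖ξ‖ ^ n) (stdGaussian E) :=
  (IsGaussian.memLp_id (stdGaussian E) n (by simp)).integrable_norm_pow'

theorem integrable_gaussCube :
    Integrable (fun ξ : E => (‖ξ‖ + ∫ η : E, ‖η‖ ∂stdGaussian E) ^ 3) (stdGaussian E) := by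
  have h : MemLp (fun ξ : E => ‖ξ‖ + ∫ η : E, ‖η‖ ∂stdGaussian E) (3 : ℕ) (stdGaussian E) :=
    (IsGaussian.memLp_id (stdGaussian E) (3 : ℕ) (by simp)).norm.add (memLp_const _)
  refine h.integrable_norm_pow'.congr (ae_of_all _ fun ξ => ?_)
  have : 0 ≤ ∫ η : E, ‖η‖ ∂stdGaussian E := integral_nonneg fun _ => norm_nonneg _
  simp only [Real.norm_eq_abs]
  rw [abs_of_nonneg (by positivity)]

theorem gaussAvg_exp_le {G : E → ℝ} {L : ℝ≥0} (hG : LipschitzWith L G) {B : ℝ}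
    (hB : ∀ y, |G y| ≤ B) {h : ℝ} (hh : 0 ≤ h) {V : ℝ} {x : E} (hV : gaussVar h G x ≤ V) (t : ℝ) :
    gaussAvg h (fun y => Real.exp (t * G y)) x ≤
      Real.exp (t * gaussAvg h G x +
        (t ^ 2 * V / 2 + Real.exp (|t| * (B + B)) * ((|t| * L * h) ^ 3 * gaussCube E))) := by
  have hc := hG.continuous
  have hi := integrable_comp_add_smul hc hB h x
  have hn := integrable_norm_pow_stdGaussian (E := E) 1
  simp only [pow_one] at hn
  let u : E → ℝ := fun ξ => t * (G (x + h • ξ) - gaussAvg h G x)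
  have hum : Measurable u := Continuous.measurable (by unfold u; fun_prop)
  have hub : ∀ ξ, |u ξ| ≤ |t| * (B + B) := fun ξ => by
    unfold u
    rw [abs_mul]
    gcongr
    exact (abs_sub _ _).trans (add_le_add (hB _) (abs_gaussAvg_le hB _ _))
  have hu0 : ∫ ξ, u ξ ∂stdGaussian E = 0 := by
    unfold u
    rw [integral_const_mul, integral_sub hi (integrable_const _)]
    simp [gaussAvg]
  -- Writing the mean as an integral over an independent copy `η` shows that `u` is of order `h`,
  -- hence that the cubic error is of order `h³`.
  have hu3 : ∀ ξ, |u ξ| ≤ |t| * L * h * (‖ξ‖ + ∫ η : E, ‖η‖ ∂stdGaussian E) := fun ξ => by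
    have : G (x + h • ξ) - gaussAvg h G x =
        ∫ η, (G (x + h • ξ) - G (x + h • η)) ∂stdGaussian E := by
      rw [integral_sub (integrable_const _) hi]; simp [gaussAvg]
    unfold u
    rw [abs_mul, this, mul_assoc, mul_assoc]
    gcongr
    calc |∫ η, (G (x + h • ξ) - G (x + h • η)) ∂stdGaussian E|
        ≤ ∫ η, |G (x + h • ξ) - G (x + h • η)| ∂stdGaussian E := abs_integral_le_integral_abs
      _ ≤ ∫ η : E, L * (h * (‖ξ‖ + ‖η‖)) ∂stdGaussian E := by
          refine integral_mono_of_nonneg (ae_of_all _ fun _ => abs_nonneg _)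
            ((((integrable_const _).add hn).const_mul _).const_mul _) (ae_of_all _ fun η => ?_)
          have := hG.dist_le_mul (x + h • ξ) (x + h • η)
          rw [Real.dist_eq, dist_add_left, dist_eq_norm, ← smul_sub, norm_smul, Real.norm_eq_abs,
            abs_of_nonneg hh] at this
          refine this.trans ?_
          beta_reduce
          gcongr
          exact norm_sub_le _ _
      _ = L * (h * (‖ξ‖ + ∫ η : E, ‖η‖ ∂stdGaussian E)) := by
          rw [integral_const_mul, integral_const_mul, integral_add (integrable_const _) hn]
          simp
  have hV2 : ∫ ξ, u ξ ^ 2 ∂stdGaussian E ≤ t ^ 2 * V := by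
    unfold u
    simp_rw [mul_pow]
    rw [integral_const_mul]
    gcongr
    exact hV
  have hcube : ∫ ξ, |u ξ| ^ 3 ∂stdGaussian E ≤ (|t| * L * h) ^ 3 * gaussCube E := by
    rw [gaussCube, ← integral_const_mul]
    refine integral_mono_of_nonneg (ae_of_all _ fun _ => by positivity)
      (integrable_gaussCube.const_mul _) (ae_of_all _ fun ξ => ?_)
    simp only
    rw [← mul_pow]
    gcongr
    exact hu3 ξ
  have main := integral_exp_le_of_integral_eq_zero hum hub hu0
  have hs : gaussAvg h (fun y => Real.exp (t * G y)) x =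
      Real.exp (t * gaussAvg h G x) * ∫ ξ, Real.exp (u ξ) ∂stdGaussian E := by
    rw [← integral_const_mul, gaussAvg]
    congr with ξ
    rw [← Real.exp_add]
    congr 1
    unfold u
    ring
  rw [hs, Real.exp_add]
  gcongr
  refine main.trans (Real.exp_le_exp.2 ?_)
  gcongr

theorem gaussAvg_mono {F G : E → ℝ} (hF : Continuous F) (hG : Continuous G) {A B : ℝ}
    (hA : ∀ y, |F y| ≤ A) (hB : ∀ y, |G y| ≤ B) (hFG : ∀ y, F y ≤ G y) (h : ℝ) (x : E) :
    gaussAvg h F x ≤ gaussAvg h G x :=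
  integral_mono (integrable_comp_add_smul hF hA h x) (integrable_comp_add_smul hG hB h x)
    fun _ => hFG _

theorem abs_exp_mul_le {s B : ℝ} (hs : |s| ≤ B) (t : ℝ) :
    |Real.exp (t * s)| ≤ Real.exp (|t| * B) := by
  rw [Real.abs_exp]
  refine Real.exp_le_exp.2 ((le_abs_self _).trans ?_)
  rw [abs_mul]
  gcongr

theorem continuous_gaussAvg {G : E → ℝ} (hG : Continuous G) {B : ℝ} (hB : ∀ y, |G y| ≤ B)
    (h : ℝ) : Continuous (gaussAvg h G) :=
  continuous_of_dominated (fun x => (integrable_comp_add_smul hG hB h x).1)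
    (fun _ => ae_of_all _ fun _ => hB _) (integrable_const B)
    (ae_of_all _ fun ξ => by fun_prop)

theorem gaussAvg_iterate_exp_le {h : ℝ} (hh : 0 ≤ h) {L : ℝ≥0} {B V : ℝ} (t : ℝ) (n : ℕ) :
    ∀ {G : E → ℝ}, LipschitzWith L G → (∀ y, |G y| ≤ B) → (∀ x, gaussVar h G x ≤ V) → ∀ x,
    gaussAvg (√n * h) (fun y => Real.exp (t * G y)) x ≤
      Real.exp (t * gaussAvg (√n * h) G x + n *
        (t ^ 2 * V / 2 + Real.exp (|t| * (B + B)) * ((|t| * L * h) ^ 3 * gaussCube E))) := by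
  set κ := (t ^ 2 * V / 2 + Real.exp (|t| * (B + B)) * ((|t| * L * h) ^ 3 * gaussCube E))
  induction n with
  | zero => intro G hG hB hV x; simp [gaussAvg]
  | succ n ih =>
    intro G hG hB hV x
    have hsq : (√((n + 1 : ℕ) : ℝ) * h) ^ 2 = (√n * h) ^ 2 + h ^ 2 := by
      rw [mul_pow, mul_pow, Real.sq_sqrt (by positivity), Real.sq_sqrt (by positivity)]
      push_cast; ring
    have hc := hG.continuous
    have hec : Continuous fun y => Real.exp (t * G y) := by fun_prop
    have heb : ∀ y, |Real.exp (t * G y)| ≤ Real.exp (|t| * B) := fun y => abs_exp_mul_le (hB y) t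
    have hAL := lipschitzWith_gaussAvg hG hB h
    have hAb := abs_gaussAvg_le hB h
    have hAc := hAL.continuous
    have hAe : ∀ y, |Real.exp (t * gaussAvg h G y)| ≤ Real.exp (|t| * B) :=
      fun y => abs_exp_mul_le (hAb y) t
    -- The innermost step is estimated by the one-step bound; the remaining `n` steps act on
    -- `gaussAvg h G`, which is why the induction quantifies over `G`.
    rw [← gaussAvg_gaussAvg hsq hec heb, ← gaussAvg_gaussAvg hsq hc hB]
    calc gaussAvg (√n * h) (gaussAvg h fun y => Real.exp (t * G y)) x
        ≤ gaussAvg (√n * h) (fun y => Real.exp κ * Real.exp (t * gaussAvg h G y)) x := by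
          refine gaussAvg_mono (continuous_gaussAvg hec heb h) (by fun_prop)
            (abs_gaussAvg_le heb h) (B := Real.exp κ * Real.exp (|t| * B)) (fun y => ?_)
            (fun y => ?_) _ _
          · rw [abs_mul, Real.abs_exp]
            gcongr
            exact hAe y
          · rw [← Real.exp_add, add_comm]
            exact gaussAvg_exp_le hG hB hh (hV y) t
      _ = Real.exp κ * gaussAvg (√n * h) (fun y => Real.exp (t * gaussAvg h G y)) x := by
          unfold gaussAvg; rw [integral_const_mul]
      _ ≤ Real.exp κ * Real.exp (t * gaussAvg (√n * h) (gaussAvg h G) x + n * κ) := by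
          gcongr
          exact ih hAL hAb (gaussVar_gaussAvg_le hG hB h hV) x
      _ = _ := by
          rw [← Real.exp_add]; congr 1; push_cast; ring

end Counterfactual

/-! ### Sharp concentration for functions with Lipschitz derivative. -/

namespace Counterfactual

theorem abs_sub_sub_fderiv_le {E : Type*} [NormedAddCommGroup E] [NormedSpace ℝ E]
    {G : E → ℝ} {G' : E → E →L[ℝ] ℝ}
    (hd : ∀ x, HasFDerivAt G (G' x) x) {C : ℝ≥0} (hC : LipschitzWith C G') (x v : E) :
    |G (x + v) - G x - G' x v| ≤ C * ‖v‖ ^ 2 := by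
  have := (convex_closedBall x ‖v‖).norm_image_sub_le_of_norm_hasFDerivWithin_le'
    (f := G) (f' := G') (φ := G' x) (C := C * ‖v‖) (x := x) (y := x + v)
    (fun y _ => (hd y).hasFDerivWithinAt) (fun y hy => ?_) (by simp) (by simp)
  · simpa [pow_two, mul_assoc] using this
  · rw [← dist_eq_norm]
    refine (hC.dist_le_mul y x).trans ?_
    gcongr
    exact hy

/-- Vector-valued kernels are allowed so that the bound serves both for a mollified function (bump
kernel) and for its derivative (kernel the derivative of the bump). -/
theorem lipschitzWith_convolution {E W W' : Type*} [NormedAddCommGroup E] [MeasurableSpace E]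
    [BorelSpace E] [NormedAddCommGroup W] [NormedSpace ℝ W]
    [NormedAddCommGroup W'] [NormedSpace ℝ W'] (T : W →L[ℝ] ℝ →L[ℝ] W') {k : E → W}
    (hk : Continuous k) (hks : HasCompactSupport k) {μ : Measure E} [μ.IsAddHaarMeasure]
    {g : E → ℝ} {L : ℝ≥0} (hg : LipschitzWith L g) :
    LipschitzWith (‖T‖₊ * (∫ t, ‖k t‖ ∂μ).toNNReal * L) (convolution k g T μ) := by
  refine LipschitzWith.of_dist_le_mul fun x y => ?_
  rw [dist_eq_norm, dist_eq_norm]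
  have hi : ∀ z, Integrable (fun t => T (k t) (g (z - t))) μ := fun z => by
    have := hg.continuous
    refine Continuous.integrable_of_hasCompactSupport (by fun_prop) ?_
    exact hks.mono fun t ht => by
      contrapose! ht
      simp [Function.notMem_support.1 ht]
  rw [convolution_def, convolution_def, ← integral_sub (hi x) (hi y)]
  calc ‖∫ t, (T (k t) (g (x - t)) - T (k t) (g (y - t))) ∂μ‖
      ≤ ∫ t, ‖T‖ * ‖k t‖ * (L * ‖x - y‖) ∂μ := by
        refine norm_integral_le_of_norm_le
          (((hk.norm.integrable_of_hasCompactSupport hks.norm).const_mul _).mul_const _)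
          (ae_of_all _ fun t => ?_)
        rw [← map_sub]
        refine (T.le_opNorm₂ _ _).trans ?_
        gcongr
        have := hg.dist_le_mul (x - t) (y - t)
        rwa [dist_sub_right, dist_eq_norm, dist_eq_norm] at this
    _ = _ := by rw [integral_mul_const, integral_const_mul, NNReal.coe_mul, NNReal.coe_mul, coe_nnnorm,
          Real.coe_toNNReal _ (integral_nonneg fun _ => norm_nonneg _)]; ring

variable {E : Type*} [NormedAddCommGroup E] [InnerProductSpace ℝ E] [FiniteDimensional ℝ E]
  [MeasurableSpace E] [BorelSpace E]

theorem gaussVar_le_integral_sq {G : E → ℝ} (hG : Continuous G) (h : ℝ) (x : E) :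
    gaussVar h G x ≤ ∫ ξ, (G (x + h • ξ) - G x) ^ 2 ∂stdGaussian E := by
  have hm : Measurable fun ξ : E => G (x + h • ξ) := Continuous.measurable (by fun_prop)
  have h1 : gaussVar h G x = Var[fun ξ => G (x + h • ξ); stdGaussian E] :=
    (variance_eq_integral hm.aemeasurable).symm
  rw [h1, ← variance_sub_const hm.aestronglyMeasurable (G x)]
  exact variance_le_expectation_sq (hm.sub_const _).aestronglyMeasurable

theorem integral_sq_strongDual_stdGaussian (l : E →L[ℝ] ℝ) :
    ∫ ξ, l ξ ^ 2 ∂stdGaussian E = ‖l‖ ^ 2 := by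
  rw [← variance_dual_stdGaussian l,
    variance_of_integral_eq_zero (by fun_prop) (integral_strongDual_stdGaussian l)]

/-- To first order `G` is affine, and a linear form `l` has Gaussian variance exactly `‖l‖²`, with
no dimensional factor. This is the source of the sharp constant; the remainder has higher order in
`h`. -/
theorem gaussVar_le_of_lipschitz_fderiv {G : E → ℝ} {L : ℝ≥0} (hG : LipschitzWith L G)
    {G' : E → E →L[ℝ] ℝ} (hd : ∀ x, HasFDerivAt G (G' x) x) {C : ℝ≥0}
    (hC : LipschitzWith C G') {h : ℝ} (hh : 0 ≤ h) (x : E) :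
    gaussVar h G x ≤ h ^ 2 * (L ^ 2 + h * (2 * C * L * ∫ ξ : E, ‖ξ‖ ^ 3 ∂stdGaussian E) +
      h ^ 2 * (C ^ 2 * ∫ ξ : E, ‖ξ‖ ^ 4 ∂stdGaussian E)) := by
  have hL : ‖G' x‖ ≤ L := (hd x).le_of_lipschitz hG
  have i2 : Integrable (fun ξ => G' x ξ ^ 2) (stdGaussian E) :=
    (IsGaussian.memLp_dual (stdGaussian E) (G' x) 2 (by simp)).integrable_sq
  have i3 := integrable_norm_pow_stdGaussian (E := E) 3
  have i4 := integrable_norm_pow_stdGaussian (E := E) 4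
  have j1 : Integrable (fun ξ => h ^ 2 * (G' x ξ ^ 2) + h ^ 3 * (2 * C * L) * ‖ξ‖ ^ 3)
    (stdGaussian E) := (i2.const_mul _).add (i3.const_mul _)
  calc gaussVar h G x ≤ ∫ ξ, (G (x + h • ξ) - G x) ^ 2 ∂stdGaussian E :=
        gaussVar_le_integral_sq hG.continuous h x
    _ ≤ ∫ ξ, (h ^ 2 * (G' x ξ ^ 2) + h ^ 3 * (2 * C * L) * ‖ξ‖ ^ 3 +
          h ^ 4 * C ^ 2 * ‖ξ‖ ^ 4) ∂stdGaussian E := by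
        refine integral_mono_of_nonneg (ae_of_all _ fun _ => sq_nonneg _)
          (j1.add (i4.const_mul _)) (ae_of_all _ fun ξ => ?_)
        have h1 := abs_sub_sub_fderiv_le hd hC x (h • ξ)
        rw [map_smul, smul_eq_mul, norm_smul, Real.norm_eq_abs, abs_of_nonneg hh] at h1
        have h2 : |G' x ξ| ≤ L * ‖ξ‖ := (G' x).le_of_opNorm_le hL ξ
        have h3 : |G (x + h • ξ) - G x| ≤ h * |G' x ξ| + C * (h * ‖ξ‖) ^ 2 := by
          have := abs_add_le (G (x + h • ξ) - G x - h * G' x ξ) (h * G' x ξ)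
          rw [sub_add_cancel, abs_mul h, abs_of_nonneg hh] at this
          linarith
        beta_reduce
        rw [← sq_abs]
        calc |G (x + h • ξ) - G x| ^ 2 ≤ (h * |G' x ξ| + C * (h * ‖ξ‖) ^ 2) ^ 2 := by gcongr
          _ = h ^ 2 * |G' x ξ| ^ 2 + h ^ 3 * (2 * C) * ‖ξ‖ ^ 2 * |G' x ξ| +
              h ^ 4 * C ^ 2 * ‖ξ‖ ^ 4 := by ring
          _ ≤ h ^ 2 * |G' x ξ| ^ 2 + h ^ 3 * (2 * C) * ‖ξ‖ ^ 2 * (L * ‖ξ‖) +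
              h ^ 4 * C ^ 2 * ‖ξ‖ ^ 4 := by gcongr
          _ = _ := by rw [sq_abs]; ring
    _ = h ^ 2 * ‖G' x‖ ^ 2 + h ^ 3 * (2 * C * L) * ∫ ξ : E, ‖ξ‖ ^ 3 ∂stdGaussian E +
          h ^ 4 * C ^ 2 * ∫ ξ : E, ‖ξ‖ ^ 4 ∂stdGaussian E := by
        rw [integral_add j1 (i4.const_mul _), integral_add (i2.const_mul _) (i3.const_mul _),
          integral_const_mul, integral_const_mul, integral_const_mul,
          integral_sq_strongDual_stdGaussian]
    _ ≤ h ^ 2 * L ^ 2 + h ^ 3 * (2 * C * L) * ∫ ξ : E, ‖ξ‖ ^ 3 ∂stdGaussian E +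
          h ^ 4 * C ^ 2 * ∫ ξ : E, ‖ξ‖ ^ 4 ∂stdGaussian E := by gcongr
    _ = _ := by ring

theorem gaussAvg_exp_le_of_lipschitz_fderiv {G : E → ℝ} {L : ℝ≥0} (hG : LipschitzWith L G) {B : ℝ}
    (hB : ∀ y, |G y| ≤ B) {G' : E → E →L[ℝ] ℝ} (hd : ∀ x, HasFDerivAt G (G' x) x) {C : ℝ≥0}
    (hC : LipschitzWith C G') {σ : ℝ} (hσ : 0 ≤ σ) (t : ℝ) (x : E) :
    gaussAvg σ (fun y => Real.exp (t * G y)) x ≤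
      Real.exp (t * gaussAvg σ G x + t ^ 2 * L ^ 2 * σ ^ 2 / 2) := by
  set K3 := 2 * C * L * ∫ ξ : E, ‖ξ‖ ^ 3 ∂stdGaussian E
  set K4 := C ^ 2 * ∫ ξ : E, ‖ξ‖ ^ 4 ∂stdGaussian E
  set K := Real.exp (|t| * (B + B)) * ((|t| * L) ^ 3 * gaussCube E)
  -- This is the bound after `n` steps once `n * h ^ 2` is replaced by `σ ^ 2`; the cubic errors sum
  -- to `σ ^ 2 * K * h` and vanish with `h`.
  let f : ℝ → ℝ := fun h => Real.exp (t * gaussAvg σ G x +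
    σ ^ 2 * (t ^ 2 * (L ^ 2 + h * K3 + h ^ 2 * K4) / 2 + K * h))
  have hf : Continuous f := by unfold f; fun_prop
  have hn : Filter.Tendsto (fun n : ℕ => σ / √n) Filter.atTop (nhds 0) :=
    Filter.Tendsto.const_div_atTop
      (Real.tendsto_sqrt_atTop.comp tendsto_natCast_atTop_atTop) σ
  have hlim : Filter.Tendsto (fun n : ℕ => f (σ / √n)) Filter.atTop
      (nhds (Real.exp (t * gaussAvg σ G x + t ^ 2 * L ^ 2 * σ ^ 2 / 2))) := by
    have h0 : f 0 = Real.exp (t * gaussAvg σ G x + t ^ 2 * L ^ 2 * σ ^ 2 / 2) := by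
      unfold f; congr 1; ring
    rw [← h0]
    exact (hf.tendsto 0).comp hn
  refine ge_of_tendsto hlim (Filter.eventually_atTop.2 ⟨1, fun n hn1 => ?_⟩)
  have hs : 0 < √(n : ℝ) := Real.sqrt_pos.2 (by exact_mod_cast hn1)
  set h := σ / √n with hdef
  have hh : 0 ≤ h := by positivity
  have e1 : √n * h = σ := by rw [hdef]; field_simp
  have e2 : n * h ^ 2 = σ ^ 2 := by
    rw [← e1, mul_pow, Real.sq_sqrt (by positivity)]
  have := gaussAvg_iterate_exp_le hh t n hG hB
    (fun x => gaussVar_le_of_lipschitz_fderiv hG hd hC hh x) x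
  rw [e1] at this
  refine this.trans_eq ?_
  unfold f
  rw [← e2]
  congr 1
  unfold K
  ring

/-! ### Mollification and concentration for all bounded Lipschitz functions. -/

theorem exists_smooth_approx {g : E → ℝ} {L : ℝ≥0} (hg : LipschitzWith L g) {δ : ℝ} (hδ : 0 < δ) :
    ∃ (G : E → ℝ) (G' : E → E →L[ℝ] ℝ) (C : ℝ≥0), LipschitzWith L G ∧
      (∀ x, HasFDerivAt G (G' x) x) ∧ LipschitzWith C G' ∧ ∀ x, |G x - g x| ≤ L * δ := by
  let φ : ContDiffBump (0 : E) := ⟨δ / 2, δ, by positivity, by linarith⟩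
  let μ : Measure E := volume
  have hc : ContDiff ℝ 1 (φ.normed μ) := φ.contDiff_normed
  have hs : HasCompactSupport (φ.normed μ) := φ.hasCompactSupport_normed
  refine ⟨convolution (φ.normed μ) g (ContinuousLinearMap.lsmul ℝ ℝ) μ, _, _, ?_,
    fun x => hs.hasFDerivAt_convolution_left _ hc hg.continuous.locallyIntegrable x,
    lipschitzWith_convolution _ (hc.continuous_fderiv one_ne_zero) (hs.fderiv ℝ) hg, fun x => ?_⟩
  · refine (lipschitzWith_convolution _ hc.continuous hs hg).weaken ?_
    have : ∫ t, ‖φ.normed μ t‖ ∂μ = 1 := by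
      rw [← φ.integral_normed (μ := μ)]
      congr with t
      exact Real.norm_of_nonneg (φ.nonneg_normed t)
    rw [this, Real.toNNReal_one, mul_one]
    exact mul_le_of_le_one_left L.2 ContinuousLinearMap.opNorm_lsmul_le
  · refine ContDiffBump.dist_normed_convolution_le hg.continuous.aestronglyMeasurable
      fun y hy => (hg.dist_le_mul y x).trans ?_
    gcongr
    exact (Metric.mem_ball.1 hy).le

theorem gaussAvg_exp_le_of_lipschitz {g : E → ℝ} {L : ℝ≥0} (hg : LipschitzWith L g) {B : ℝ}
    (hB : ∀ y, |g y| ≤ B) {σ : ℝ} (hσ : 0 ≤ σ) (t : ℝ) (x : E) :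
    gaussAvg σ (fun y => Real.exp (t * g y)) x ≤
      Real.exp (t * gaussAvg σ g x + t ^ 2 * L ^ 2 * σ ^ 2 / 2) := by
  -- The approximation error `L * δ` enters twice: in the exponential moment and in the mean.
  let f : ℝ → ℝ := fun δ => Real.exp (|t| * (L * δ)) *
    Real.exp (t * gaussAvg σ g x + |t| * (L * δ) + t ^ 2 * L ^ 2 * σ ^ 2 / 2)
  have hf : Continuous f := by unfold f; fun_prop
  have hlim : Filter.Tendsto f (nhdsWithin 0 (Set.Ioi 0))
      (nhds (Real.exp (t * gaussAvg σ g x + t ^ 2 * L ^ 2 * σ ^ 2 / 2))) := by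
    have h0 : f 0 = Real.exp (t * gaussAvg σ g x + t ^ 2 * L ^ 2 * σ ^ 2 / 2) := by
      simp [f]
    rw [← h0]
    exact (hf.tendsto 0).mono_left nhdsWithin_le_nhds
  refine ge_of_tendsto hlim (Filter.eventually_of_mem self_mem_nhdsWithin fun δ hδ => ?_)
  obtain ⟨G, G', C, hG, hd, hC, hGg⟩ := exists_smooth_approx hg hδ
  have hGB : ∀ y, |G y| ≤ B + L * δ := fun y => by
    have := abs_add_le (g y) (G y - g y)
    rw [add_sub_cancel] at this
    linarith [hB y, hGg y]
  have hgc := hg.continuous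
  have hGc := hG.continuous
  have key : ∀ y, t * (g y - G y) ≤ |t| * (L * δ) := fun y => by
    refine (le_abs_self _).trans ?_
    rw [abs_mul, abs_sub_comm]
    gcongr
    exact hGg y
  have hmean : t * gaussAvg σ G x ≤ t * gaussAvg σ g x + |t| * (L * δ) := by
    have : |gaussAvg σ G x - gaussAvg σ g x| ≤ L * δ := by
      rw [gaussAvg, gaussAvg, ← integral_sub (integrable_comp_add_smul hGc hGB σ x)
        (integrable_comp_add_smul hgc hB σ x)]
      exact abs_integral_le_of_abs_le fun ξ => hGg _
    have h2 : t * (gaussAvg σ G x - gaussAvg σ g x) ≤ |t| * (L * δ) := by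
      refine (le_abs_self _).trans ?_
      rw [abs_mul]
      gcongr
    linarith
  calc gaussAvg σ (fun y => Real.exp (t * g y)) x
      ≤ gaussAvg σ (fun y => Real.exp (|t| * (L * δ)) * Real.exp (t * G y)) x := by
        refine gaussAvg_mono (by fun_prop) (by fun_prop) (fun y => abs_exp_mul_le (hB y) t)
          (B := Real.exp (|t| * (L * δ)) * Real.exp (|t| * (B + L * δ))) (fun y => ?_)
          (fun y => ?_) _ _
        · rw [abs_mul, Real.abs_exp]
          gcongr
          exact abs_exp_mul_le (hGB y) t
        · rw [← Real.exp_add]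
          refine Real.exp_le_exp.2 ?_
          linarith [key y]
    _ = Real.exp (|t| * (L * δ)) * gaussAvg σ (fun y => Real.exp (t * G y)) x := by
        unfold gaussAvg; rw [integral_const_mul]
    _ ≤ f δ := by
        unfold f
        gcongr
        refine (gaussAvg_exp_le_of_lipschitz_fderiv hG hGB hd hC hσ t x).trans
          (Real.exp_le_exp.2 ?_)
        linarith

/-- Gaussian concentration for bounded Lipschitz functions, with the sharp variance proxy. -/
theorem hasSubgaussianMGF_map_stdGaussian {g : E → ℝ} {L : ℝ≥0} (hg : LipschitzWith L g) {B : ℝ}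
    (hB : ∀ y, |g y| ≤ B) (σ : ℝ≥0) (x : E) :
    HasSubgaussianMGF (fun y => g y - ∫ z, g z ∂(stdGaussian E).map fun ξ => x + (σ : ℝ) • ξ)
      (L ^ 2 * σ ^ 2) ((stdGaussian E).map fun ξ => x + (σ : ℝ) • ξ) := by
  have hgc := hg.continuous
  have hmean : ∫ z, g z ∂(stdGaussian E).map (fun ξ => x + (σ : ℝ) • ξ) = gaussAvg σ g x :=
    integral_map (by fun_prop) hgc.aestronglyMeasurable
  have : IsProbabilityMeasure ((stdGaussian E).map fun ξ => x + (σ : ℝ) • ξ) :=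
    Measure.isProbabilityMeasure_map (by fun_prop)
  rw [hmean]
  constructor
  · intro t
    refine integrable_of_abs_le (Continuous.measurable (by fun_prop))
      fun y => abs_exp_mul_le (B := B + B) ?_ t
    exact (abs_sub _ _).trans (add_le_add (hB _) (abs_gaussAvg_le hB _ _))
  · intro t
    rw [mgf, integral_map (by fun_prop) (by fun_prop)]
    have h1 : ∫ ξ, Real.exp (t * (g (x + (σ : ℝ) • ξ) - gaussAvg σ g x)) ∂stdGaussian E =
        Real.exp (-(t * gaussAvg σ g x)) * gaussAvg σ (fun y => Real.exp (t * g y)) x := by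
      change _ = Real.exp (-(t * gaussAvg σ g x)) *
        ∫ ξ, Real.exp (t * g (x + (σ : ℝ) • ξ)) ∂stdGaussian E
      rw [← integral_const_mul]
      refine integral_congr_ae (ae_of_all _ fun ξ => ?_)
      beta_reduce
      rw [← Real.exp_add]
      congr 1
      ring
    rw [h1]
    refine (mul_le_mul_of_nonneg_left (gaussAvg_exp_le_of_lipschitz hg hB σ.coe_nonneg t x)
      (Real.exp_nonneg _)).trans_eq ?_
    rw [← Real.exp_add]
    congr 1
    push_cast
    ring

theorem multivariateGaussian_smul_one {d : ℕ} (x : EuclideanSpace ℝ (Fin d)) (σ : ℝ) :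
    multivariateGaussian x (σ ^ 2 • (1 : Matrix (Fin d) (Fin d) ℝ)) =
      (stdGaussian (EuclideanSpace ℝ (Fin d))).map fun ξ => x + σ • ξ := by
  have hS : (σ ^ 2 • (1 : Matrix (Fin d) (Fin d) ℝ)).PosSemidef :=
    Matrix.PosSemidef.one.smul (sq_nonneg σ)
  have h2 : (stdGaussian (EuclideanSpace ℝ (Fin d))).map (fun ξ => x + σ • ξ) =
      ((stdGaussian (EuclideanSpace ℝ (Fin d))).map (σ • ·)).map (x + ·) := by
    rw [Measure.map_map (by fun_prop) (by fun_prop)]; rfl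
  have : IsProbabilityMeasure ((stdGaussian (EuclideanSpace ℝ (Fin d))).map (σ • ·)) :=
    Measure.isProbabilityMeasure_map (by fun_prop)
  have : IsProbabilityMeasure ((stdGaussian (EuclideanSpace ℝ (Fin d))).map fun ξ => x + σ • ξ) :=
    Measure.isProbabilityMeasure_map (by fun_prop)
  apply Measure.ext_of_charFun
  ext t
  rw [charFun_multivariateGaussian hS, h2, charFun_map_const_add, charFun_map_smul,
    charFun_stdGaussian, ← Complex.exp_add]
  have h3 : t.ofLp ⬝ᵥ (σ ^ 2 • (1 : Matrix (Fin d) (Fin d) ℝ)).mulVec t.ofLp = ‖σ • t‖ ^ 2 := by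
    rw [norm_smul, mul_pow, EuclideanSpace.real_norm_sq_eq, Matrix.smul_mulVec, Matrix.one_mulVec,
      dotProduct_smul]
    simp [dotProduct, pow_two]
  rw [h3]
  congr 1
  rw [real_inner_comm]
  push_cast
  ring

end Counterfactual

/-! ### Sample averages, random Lipschitz models and conditioning. -/

namespace Counterfactual

/-- Averages of a bounded Lipschitz function over an i.i.d. Gaussian sample concentrate. -/
theorem measureReal_le_average_sub_le {d k : ℕ} (hk : 0 < k) {Ω : Type*} [MeasurableSpace Ω]
    {P : Measure Ω} {x : EuclideanSpace ℝ (Fin d)} {σ : ℝ≥0}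
    {X : Fin k → Ω → EuclideanSpace ℝ (Fin d)}
    (hXlaw : ∀ i, HasLaw (X i)
      (multivariateGaussian x ((σ : ℝ) ^ 2 • (1 : Matrix (Fin d) (Fin d) ℝ))) P)
    (hXindep : iIndepFun X P) {g : EuclideanSpace ℝ (Fin d) → ℝ} {L : ℝ≥0}
    (hg : LipschitzWith L g) {B : ℝ} (hB : ∀ y, |g y| ≤ B) {t : ℝ} (ht : 0 ≤ t) :
    P.real {ω | t ≤ (1 / (k : ℝ)) * ∑ i, g (X i ω) -
        ∫ y, g y ∂multivariateGaussian x ((σ : ℝ) ^ 2 • (1 : Matrix (Fin d) (Fin d) ℝ))} ≤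
      Real.exp (-(k * t ^ 2) / (2 * (L : ℝ) ^ 2 * σ ^ 2)) := by
  set N := multivariateGaussian x ((σ : ℝ) ^ 2 • (1 : Matrix (Fin d) (Fin d) ℝ)) with hN
  have hk' : (0 : ℝ) < k := by exact_mod_cast hk
  have hgm := hg.continuous.measurable
  have hsub : ∀ i ∈ Finset.univ,
      HasSubgaussianMGF (fun ω => g (X i ω) - ∫ y, g y ∂N) (L ^ 2 * σ ^ 2) P := fun i _ => by
    refine HasSubgaussianMGF.of_map (X := fun y => g y - ∫ y, g y ∂N) (hXlaw i).aemeasurable ?_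
    rw [(hXlaw i).map_eq, hN, multivariateGaussian_smul_one]
    exact hasSubgaussianMGF_map_stdGaussian hg hB σ x
  have hind : iIndepFun (fun i ω => g (X i ω) - ∫ y, g y ∂N) P :=
    hXindep.comp (fun _ y => g y - ∫ y, g y ∂N) fun _ => hgm.sub_const _
  have h := HasSubgaussianMGF.measure_sum_ge_le_of_iIndepFun hind hsub
    (ε := k * t) (by positivity)
  have hset : {ω | t ≤ (1 / (k : ℝ)) * ∑ i, g (X i ω) - ∫ y, g y ∂N} =
      {ω | k * t ≤ ∑ i, (g (X i ω) - ∫ y, g y ∂N)} := by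
    ext ω
    change t ≤ _ ↔ k * t ≤ _
    simp only [Finset.sum_sub_distrib, Finset.sum_const, Finset.card_univ, Fintype.card_fin,
      nsmul_eq_mul]
    rw [← mul_le_mul_iff_right₀ hk', mul_sub, ← mul_assoc, mul_one_div_cancel hk'.ne', one_mul]
  rw [hset]
  refine h.trans_eq ?_
  simp only [Finset.sum_const, Finset.card_univ, Fintype.card_fin, nsmul_eq_mul]
  push_cast
  rw [show -((k : ℝ) * t) ^ 2 = k * -(k * t ^ 2) by ring,
    show 2 * ((k : ℝ) * ((L : ℝ) ^ 2 * σ ^ 2)) = k * (2 * (L : ℝ) ^ 2 * σ ^ 2) by ring,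
    mul_div_mul_left _ _ hk'.ne']

/-- The `γ`-Lipschitz models, with the σ-algebra generated by the evaluations. -/
abbrev LipModel (d : ℕ) (γ : ℝ≥0) : Type :=
  {f : EuclideanSpace ℝ (Fin d) → ℝ // LipschitzWith γ f ∧ IsModel f}

/-- Evaluation is measurable in the model and continuous in the point, hence jointly measurable. The
continuity comes from restricting to Lipschitz models, and joint measurability is what Fubini and
the conditioning need. -/
theorem measurable_eval_lipModel {d : ℕ} {γ : ℝ≥0} :
    Measurable fun p : LipModel d γ × EuclideanSpace ℝ (Fin d) => p.1.1 p.2 := by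
  have := measurable_uncurry_of_continuous_of_measurable
    (u := fun (y : EuclideanSpace ℝ (Fin d)) (f : LipModel d γ) => f.1 y)
    (fun f => f.2.1.continuous) (fun y => (measurable_pi_apply y).comp measurable_subtype_coe)
  exact this.comp measurable_swap

/-- The average of `m - f` over a sample, as a function of the model `f` and the sample. -/
noncomputable def sampleDiff {d k : ℕ} {γ : ℝ≥0} (m : EuclideanSpace ℝ (Fin d) → ℝ)
    (p : LipModel d γ × (Fin k → EuclideanSpace ℝ (Fin d))) : ℝ :=
  (1 / (k : ℝ)) * ∑ i, (m (p.2 i) - p.1.1 (p.2 i))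

section

variable {d k : ℕ} {γ : ℝ≥0} {m : EuclideanSpace ℝ (Fin d) → ℝ}

theorem measurable_sampleDiff (hm : Measurable m) :
    Measurable (sampleDiff m : LipModel d γ × (Fin k → EuclideanSpace ℝ (Fin d)) → ℝ) := by
  refine (Finset.measurable_sum _ fun i _ => ?_).const_mul _
  have h1 : Measurable fun p : LipModel d γ × (Fin k → EuclideanSpace ℝ (Fin d)) => p.2 i :=
    (measurable_pi_apply i).comp measurable_snd
  exact (hm.comp h1).sub (measurable_eval_lipModel.comp (measurable_fst.prodMk h1))

theorem abs_sub_le_one_of_isModel {f : EuclideanSpace ℝ (Fin d) → ℝ} (hm : IsModel m)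
    (hf : IsModel f) (y : EuclideanSpace ℝ (Fin d)) : |m y - f y| ≤ 1 := by
  obtain ⟨h1, h2⟩ := hm y
  obtain ⟨h3, h4⟩ := hf y
  rw [abs_le]
  constructor <;> linarith

theorem abs_sampleDiff_le (hm : IsModel m)
    (p : LipModel d γ × (Fin k → EuclideanSpace ℝ (Fin d))) : |sampleDiff m p| ≤ 1 := by
  have h : |∑ i, (m (p.2 i) - p.1.1 (p.2 i))| ≤ k := by
    refine (Finset.abs_sum_le_sum_abs _ _).trans ?_
    refine (Finset.sum_le_sum fun i _ => abs_sub_le_one_of_isModel hm p.1.2.2 (p.2 i)).trans ?_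
    simp
  rw [sampleDiff, abs_mul, abs_of_nonneg (by positivity)]
  refine (mul_le_mul_of_nonneg_left h (by positivity)).trans ?_
  rw [one_div]
  exact inv_mul_le_one

/-- Integrating over the model first, with the sample fixed, makes every summand vanish by centring,
whatever the law `Q` of the sample. -/
theorem integral_sampleDiff_prod_eq_zero {μ : Measure (LipModel d γ)} [IsProbabilityMeasure μ]
    {Q : Measure (Fin k → EuclideanSpace ℝ (Fin d))} [IsProbabilityMeasure Q]
    (hm : IsModel m) (hmm : Measurable m) (hμ : ∀ y, ∫ f, f.1 y ∂μ = m y) :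
    ∫ p, sampleDiff m p ∂μ.prod Q = 0 := by
  rw [integral_prod_symm _ (integrable_of_abs_le (measurable_sampleDiff hmm)
    (abs_sampleDiff_le hm))]
  have h : ∀ xs : Fin k → EuclideanSpace ℝ (Fin d), ∫ f, sampleDiff m (f, xs) ∂μ = 0 := fun xs => by
    have hi : ∀ y, Integrable (fun f : LipModel d γ => f.1 y) μ := fun y =>
      integrable_of_abs_le (B := 1) ((measurable_pi_apply y).comp measurable_subtype_coe)
        fun f => abs_le.2 ⟨by linarith [(f.2.2 y).1], (f.2.2 y).2⟩
    simp only [sampleDiff]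
    have hi' : ∀ y, Integrable (fun f : LipModel d γ => m y - f.1 y) μ := fun y =>
      (integrable_const _).sub (hi y)
    rw [integral_const_mul, integral_finsetSum _ fun i _ => hi' _]
    refine mul_eq_zero_of_right _ (Finset.sum_eq_zero fun i _ => ?_)
    rw [integral_sub (integrable_const _) (hi _), hμ]
    simp
  simp [h]

/-- The conditional expectation of a function of two independent random variables. -/
theorem condExp_ae_eq_integral_of_indepFun {Ω S T : Type*} [MeasurableSpace Ω] [MeasurableSpace S]
    [MeasurableSpace T] [StandardBorelSpace T] [Nonempty T] {P : Measure Ω} [IsProbabilityMeasure P]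
    {U : Ω → S} {Y : Ω → T} (hU : Measurable U) (hY : AEMeasurable Y P) (hUY : IndepFun U Y P)
    {f : S × T → ℝ} (hf : StronglyMeasurable f) (hfi : Integrable (fun ω => f (U ω, Y ω)) P) :
    P[fun ω => f (U ω, Y ω) | MeasurableSpace.comap U inferInstance] =ᵐ[P]
      fun ω => ∫ y, f (U ω, y) ∂P.map Y := by
  have : IsProbabilityMeasure (P.map Y) := Measure.isProbabilityMeasure_map hY
  -- By independence the joint law is a product, so the conditional law of `Y` given `U` is the
  -- constant kernel.
  have h1 := condDistrib_ae_eq_of_measure_eq_compProd (κ := Kernel.const S (P.map Y)) U hY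
    (by rw [Measure.compProd_const]; exact hUY.map_prod_eq_prod_map_map hU.aemeasurable hY)
  filter_upwards [condExp_prod_ae_eq_integral_condDistrib hU hY hf hfi,
    ae_of_ae_map hU.aemeasurable h1] with ω h2 h3
  rw [h2, h3, Kernel.const_apply]

/-- By the Lipschitz property of the changed model, the Stability exceeds its value at `x` by at
most the average difference of the two models over the sample. -/
theorem stability_sub_le_meanDiff (hk : 0 < k) {Ω : Type*} {M : Ω → EuclideanSpace ℝ (Fin d) → ℝ}
    {ω : Ω} (hM : LipschitzWith γ (M ω)) (x : EuclideanSpace ℝ (Fin d))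
    (X : Fin k → Ω → EuclideanSpace ℝ (Fin d)) :
    stability γ x m (fun i => X i ω) - M ω x ≤ meanDiff m M X ω := by
  have hk' : (0 : ℝ) < k := by exact_mod_cast hk
  have h : M ω x = (1 / (k : ℝ)) * ∑ _i : Fin k, M ω x := by
    simp only [Finset.sum_const, Finset.card_univ, Fintype.card_fin, nsmul_eq_mul]
    field_simp
  rw [h, stability, meanDiff, ← mul_sub, ← Finset.sum_sub_distrib]
  refine mul_le_mul_of_nonneg_left (Finset.sum_le_sum fun i _ => ?_) (by positivity)
  have := (le_abs_self _).trans (hM.dist_le_mul (X i ω) x)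
  rw [dist_comm, dist_eq_norm] at this
  linarith

end

end Counterfactual

/-! ### The Stability bound. -/

theorem mainTheorem1 {d k : ℕ} (hk : 0 < k)
    {Ω : Type*} [MeasurableSpace Ω] (P : Measure Ω) [IsProbabilityMeasure P]
    (𝒳 : Set (EuclideanSpace ℝ (Fin d)))
    (m : EuclideanSpace ℝ (Fin d) → ℝ) (hm : Counterfactual.IsModel m)
    (M : Ω → EuclideanSpace ℝ (Fin d) → ℝ)
    (γm γ : ℝ≥0) (hγ : 0 < γm + γ) (ν : ℝ)
    (hmLip : LipschitzWith γm m)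
    (hM : Counterfactual.IsNaturallyOccurring P 𝒳 m M γm γ ν)
    (x : EuclideanSpace ℝ (Fin d)) (σ : ℝ) (hσ : 0 < σ)
    (X : Fin k → Ω → EuclideanSpace ℝ (Fin d))
    (hXlaw : ∀ i, HasLaw (X i)
      (multivariateGaussian x (σ ^ 2 • (1 : Matrix (Fin d) (Fin d) ℝ))) P)
    (hXindep : iIndepFun X P)
    (hMX : IndepFun M (fun ω i => X i ω) P)
    (ε' : ℝ)
    (hZ : ∀ᵐ ω ∂P,
      |(P[Counterfactual.meanDiff m M X | MeasurableSpace.comap M MeasurableSpace.pi]) ω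
        - ∫ ω', Counterfactual.meanDiff m M X ω' ∂P| < ε')
    (ε : ℝ) (hε : 2 * ε' < ε) :
    1 - Real.exp (-(k * ε ^ 2) / (8 * ((γm : ℝ) + γ) ^ 2 * σ ^ 2))
      ≤ P.real {ω | M ω x ≥ Counterfactual.stability γ x m (fun i => X i ω) - ε} := by
  open Counterfactual in
  lift σ to ℝ≥0 using hσ.le
  have hML := hM.lipschitz hmLip
  have hmm := hmLip.continuous.measurable
  let U : Ω → LipModel d γ := fun ω => ⟨M ω, hML ω, hM.isModel ω⟩
  let Y : Ω → Fin k → EuclideanSpace ℝ (Fin d) := fun ω i => X i ω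
  have hU : Measurable U := hM.measurable.subtype_mk
  have hY : AEMeasurable Y P := aemeasurable_pi_lambda _ fun i => (hXlaw i).aemeasurable
  -- The subtype carries the pulled-back σ-algebra, so conditioning on `M` and on `U` is the same.
  have hcomap : MeasurableSpace.comap M MeasurableSpace.pi =
      MeasurableSpace.comap U inferInstance := by
    change _ = MeasurableSpace.comap U (MeasurableSpace.comap Subtype.val MeasurableSpace.pi)
    rw [MeasurableSpace.comap_comp]
    rfl
  have hUY : IndepFun U Y P := by
    rw [IndepFun_iff_Indep] at hMX ⊢
    rwa [← hcomap]
  have : IsProbabilityMeasure (P.map U) := Measure.isProbabilityMeasure_map hU.aemeasurable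
  have : IsProbabilityMeasure (P.map Y) := Measure.isProbabilityMeasure_map hY
  have hΦ := measurable_sampleDiff (k := k) (γ := γ) hmm
  have hUYm : AEMeasurable (fun ω => (U ω, Y ω)) P := hU.aemeasurable.prodMk hY
  have hlaw := hUY.map_prod_eq_prod_map_map hU.aemeasurable hY
  have hZeq : meanDiff m M X = fun ω => sampleDiff m (U ω, Y ω) := rfl
  have hmean : ∫ ω, meanDiff m M X ω ∂P = 0 := by
    rw [hZeq, ← integral_map (f := sampleDiff m) hUYm hΦ.aestronglyMeasurable, hlaw]
    refine integral_sampleDiff_prod_eq_zero hm hmm fun y => ?_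
    have hy : Measurable fun f : LipModel d γ => f.1 y :=
      (measurable_pi_apply y).comp measurable_subtype_coe
    rw [integral_map hU.aemeasurable hy.aestronglyMeasurable]
    exact hM.mean_eq y
  have hfi : Integrable (fun ω => sampleDiff m (U ω, Y ω)) P :=
    Integrable.of_bound (hΦ.comp_aemeasurable hUYm).aestronglyMeasurable 1
      (ae_of_all _ fun ω => abs_sampleDiff_le hm _)
  have hcond := condExp_ae_eq_integral_of_indepFun hU hY hUY hΦ.stronglyMeasurable hfi
  let N := multivariateGaussian x ((σ : ℝ) ^ 2 • (1 : Matrix (Fin d) (Fin d) ℝ))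
  have hdiff : ∀ f : LipModel d γ, LipschitzWith (γm + γ) fun y => m y - f.1 y :=
    fun f => hmLip.sub f.2.1
  have hψ : ∀ f : LipModel d γ, ∫ xs, sampleDiff m (f, xs) ∂P.map Y = ∫ y, (m y - f.1 y) ∂N := by
    intro f
    have hc := (hdiff f).continuous
    have hf : Measurable fun xs => sampleDiff (k := k) m (f, xs) :=
      hΦ.comp measurable_prodMk_left
    rw [integral_map hY hf.aestronglyMeasurable]
    simp only [sampleDiff]
    have hi : ∀ i, ∫ ω, (m (Y ω i) - f.1 (Y ω i)) ∂P = ∫ y, (m y - f.1 y) ∂N := fun i =>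
      (hXlaw i).integral_comp hc.aestronglyMeasurable
    rw [integral_const_mul, integral_finsetSum]
    · simp_rw [hi]
      simp only [Finset.sum_const, Finset.card_univ, Fintype.card_fin, nsmul_eq_mul]
      have : (k : ℝ) ≠ 0 := by exact_mod_cast hk.ne'
      field_simp
    · intro i _
      exact Integrable.of_bound
        (hc.measurable.comp_aemeasurable (hXlaw i).aemeasurable).aestronglyMeasurable 1
        (ae_of_all _ fun ω => abs_sub_le_one_of_isModel hm f.2.2 _)
  have hsmall : ∀ᵐ ω ∂P, |∫ y, (m y - (U ω).1 y) ∂N| < ε' := by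
    rw [hcomap] at hZ
    filter_upwards [hZ, hcond] with ω h1 h2
    rw [hmean, sub_zero, hZeq, h2, hψ] at h1
    exact h1
  -- A strict upper bound on an absolute value forces `ε' > 0`, hence `ε > 0`, as the deviation `ε /
  -- 2` below requires.
  have hε0 : 0 < ε' := by
    obtain ⟨ω, hω⟩ := hsmall.exists
    exact (abs_nonneg _).trans_lt hω
  set b := Real.exp (-(k * ε ^ 2) / (8 * ((γm : ℝ) + γ) ^ 2 * σ ^ 2))
  let S : Set (LipModel d γ × (Fin k → EuclideanSpace ℝ (Fin d))) := {p | ε < sampleDiff m p}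
  have hS : MeasurableSet S := measurableSet_lt measurable_const hΦ
  have htail : P {ω | ε < meanDiff m M X ω} ≤ ENNReal.ofReal b := by
    have h1 : P {ω | ε < meanDiff m M X ω} = P.map (fun ω => (U ω, Y ω)) S :=
      (Measure.map_apply_of_aemeasurable hUYm hS).symm
    rw [h1, hlaw, Measure.prod_apply hS, lintegral_map (measurable_measure_prodMk_left hS) hU]
    calc ∫⁻ ω, P.map Y (Prod.mk (U ω) ⁻¹' S) ∂P ≤ ∫⁻ _, ENNReal.ofReal b ∂P := by
          refine lintegral_mono_ae ?_
          filter_upwards [hsmall] with ω hω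
          rw [Measure.map_apply_of_aemeasurable hY (measurable_prodMk_left hS),
            ENNReal.le_ofReal_iff_toReal_le (measure_ne_top _ _) (Real.exp_nonneg _)]
          -- The conditional mean uses up less than `ε / 2`, leaving a deviation of at least `ε /
          -- 2`; its square turns the `2` of the Gaussian tail into `8`.
          have hconc := measureReal_le_average_sub_le hk hXlaw hXindep (hdiff (U ω))
            (fun y => abs_sub_le_one_of_isModel hm (U ω).2.2 y) (t := ε / 2) (by linarith)
          refine (measureReal_mono fun ω' hω' => ?_).trans (hconc.trans_eq ?_)
          · have h2 : ε < sampleDiff m (U ω, Y ω') := hω'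
            have h3 := (abs_lt.1 hω).2
            change ε / 2 ≤ sampleDiff m (U ω, Y ω') - ∫ y, (m y - (U ω).1 y) ∂N
            linarith
          · congr 1
            push_cast
            field_simp
            ring
      _ = ENNReal.ofReal b := by simp
  have htail' : P.real {ω | ε < meanDiff m M X ω} ≤ b :=
    ENNReal.toReal_le_of_le_ofReal (Real.exp_nonneg _) htail
  -- Subadditivity over a cover replaces passing to complements, so no measurability of these events
  -- is needed.
  have hcover : (Set.univ : Set Ω) ⊆ {ω | ε < meanDiff m M X ω} ∪
      {ω | M ω x ≥ stability γ x m (fun i => X i ω) - ε} := by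
    intro ω _
    by_cases h : ε < meanDiff m M X ω
    · exact Or.inl h
    · refine Or.inr ?_
      have := stability_sub_le_meanDiff (m := m) hk (hML ω) x X
      change _ - ε ≤ M ω x
      linarith
  have h1 := (measureReal_mono (μ := P) hcover).trans (measureReal_union_le _ _)
  rw [probReal_univ] at h1
  linarith
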